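/- Let $n\ge 0$ and let $M_n$ be the space of $n\times n$ complex matrices. For $Z\in M_n$ put $|Z|=(Z^*Z)^{1/2}$ and $\mathrm{Re}\,Z=(Z+Z^*)/2$. For positive semidefinite $X,Y\in M_n$ write $X\prec_{\log}Y$ if $$\prod_{j=1}^k\lambda_j(X)\le\prod_{j=1}^k\lambda_j(Y),\qquad k=1,\dots,n,$$ with equality for $k=n$, where $\lambda_1(\cdot)\ge\dots\ge\lambda_n(\cdot)$ are the eigenvalues, counted with multiplicity and arranged in decreasing order. Then all the matrices compared below are positive semidefinite, and the following hold. (1) For all $A,B\in M_n$, $$\left|e^{A+B}\right|\prec_{\log} e^{\mathrm{Re}\,A/2}\,e^{\mathrm{Re}\,B}\,e^{\mathrm{Re}\,A/2}.$$ (2) (Cohen) For all $Z\in M_n$, $|e^Z|\prec_{\log}e^{\mathrm{Re}\,Z}$. (3) (Thompson) For all Hermitian $S,T\in M_n$, $e^{S+T}\prec_{\log}e^{S/2}e^{T}e^{S/2}$. (4) (Golden--Thompson) For all Hermitian $S,T\in M_n$, $\mathrm{Tr}\,e^{S+T}\le\mathrm{Tr}\,e^{S/2}e^{T}e^{S/2}$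 (both traces being real). -/

import Mathlib

open Matrix NormedSpace
open scoped ComplexStarModule ComplexOrder MatrixOrder

/-- Log-majorization `X ≺_log Y` of complex matrices: both matrices are positive semidefinite and,
with `λ₁ ≥ ⋯ ≥ λₙ` denoting the eigenvalues counted with multiplicity, arranged in decreasing order
(`Matrix.IsHermitian.eigenvalues₀`), the product of the `k` largest eigenvalues of `X` is at most
that of `Y` for `k = 1, …, n`, with equality for `k = n`. -/
def Matrix.LogMajorizedBy {n : ℕ} (X Y : Matrix (Fin n) (Fin n) ℂ) : Prop :=
  ∃ (hX : X.PosSemidef) (hY : Y.PosSemidef),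
    (∀ k : ℕ, 1 ≤ k → k ≤ n →
      ∏ j with j.val < k, hX.isHermitian.eigenvalues₀ j ≤
        ∏ j with j.val < k, hY.isHermitian.eigenvalues₀ j) ∧
    ∏ j, hX.isHermitian.eigenvalues₀ j = ∏ j, hY.isHermitian.eigenvalues₀ j

infix:50 " ≺log " => Matrix.LogMajorizedBy

/-! ### Lie product formula -/

section ProductFormula

variable {A : Type*} [NormedRing A]

/-! For positive semidefinite `X`, the product of the `k` largest eigenvalues is the operator norm
of the `k`-th compound of `X`. The compound is a continuous multiplicative star map, so
log-majorization reduces to norm inequalities for `ρ (exp _)`, with `ρ` any continuous, not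
necessarily additive, homomorphism of star monoids; equality at `k = n` is a determinant identity.

Both norm inequalities come from the Lie formula along powers of two. For Cohen, split `Z` into real
and imaginary parts: the factors from the imaginary part are unitary and leave the norm unchanged.
For Thompson, iterate `‖a * b‖ ^ 2 ≤ ‖a ^ 2 * b ^ 2‖` for self-adjoint `a`, `b`. Claim (1) is Cohen
at `A + B` followed by Thompson at the real parts. The trace inequality follows from Thompson by
Abel summation and `log t ≤ t - 1`. -/

theorem norm_pow_sub_pow_le {x y : A} {M : ℝ} (hM : 1 ≤ M) (hx : ‖x‖ ≤ M) (hy : ‖y‖ ≤ M) (k : ℕ) :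
    ‖x ^ (k + 1) - y ^ (k + 1)‖ ≤ (k + 1) * ‖x - y‖ * M ^ k := by
  have hpow : ∀ j : ℕ, ‖y ^ (j + 1)‖ ≤ M ^ (j + 1) := fun j =>
    (norm_pow_le' y j.succ_pos).trans (pow_le_pow_left₀ (norm_nonneg _) hy _)
  induction k with
  | zero => simp
  | succ k ih =>
    have h : x ^ (k + 1 + 1) - y ^ (k + 1 + 1) =
        x * (x ^ (k + 1) - y ^ (k + 1)) + (x - y) * y ^ (k + 1) := by
      rw [pow_succ' x (k + 1), pow_succ' y (k + 1)]; noncomm_ring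
    have hM0 : 0 ≤ M := zero_le_one.trans hM
    calc ‖x ^ (k + 1 + 1) - y ^ (k + 1 + 1)‖
        ≤ ‖x‖ * ‖x ^ (k + 1) - y ^ (k + 1)‖ + ‖x - y‖ * ‖y ^ (k + 1)‖ := by
          rw [h]
          exact (norm_add_le _ _).trans (add_le_add (norm_mul_le _ _) (norm_mul_le _ _))
      _ ≤ M * ((k + 1) * ‖x - y‖ * M ^ k) + ‖x - y‖ * M ^ (k + 1) := by
          gcongr
          exact hpow k
      _ = ((k + 1 : ℕ) + 1) * ‖x - y‖ * M ^ (k + 1) := by push_cast; ring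

open Filter Topology

variable [NormOneClass A] [NormedAlgebra ℝ A]

/-- Two curves through `1` with the same velocity have asymptotically equal powers. -/
theorem tendsto_pow_sub_pow_of_hasDerivAt {f g : ℝ → A} {c : A} (hf : HasDerivAt f c 0)
    (hg : HasDerivAt g c 0) (hf0 : f 0 = 1) (hg0 : g 0 = 1) :
    Tendsto (fun N : ℕ => f (1 / ((N : ℝ) + 1)) ^ (N + 1) - g (1 / ((N : ℝ) + 1)) ^ (N + 1))
      atTop (𝓝 0) := by
  have ht : Tendsto (fun N : ℕ => 1 / ((N : ℝ) + 1)) atTop (𝓝 0) :=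
    tendsto_one_div_add_atTop_nhds_zero_nat
  have bound : ∀ {h : ℝ → A}, HasDerivAt h c 0 → h 0 = 1 →
      ∃ C : ℝ, 0 ≤ C ∧ ∀ᶠ N : ℕ in atTop,
        ‖h (1 / ((N : ℝ) + 1))‖ ≤ 1 + C * (1 / ((N : ℝ) + 1)) := by
    intro h hh h0
    obtain ⟨C, hC, hb⟩ := (hh.isBigO_sub.comp_tendsto ht).exists_nonneg
    refine ⟨C, hC, hb.bound.mono fun N hN => ?_⟩
    simp only [Function.comp, h0, sub_zero] at hN
    rw [Real.norm_of_nonneg (by positivity)] at hN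
    have := norm_add_le (h (1 / ((N : ℝ) + 1)) - 1) 1
    rw [sub_add_cancel, norm_one] at this
    linarith
  obtain ⟨C₁, hC₁, h₁⟩ := bound hf hf0
  obtain ⟨C₂, hC₂, h₂⟩ := bound hg hg0
  have hdiff : Tendsto (fun N : ℕ => ((N : ℝ) + 1) *
      ‖f (1 / ((N : ℝ) + 1)) - g (1 / ((N : ℝ) + 1))‖) atTop (𝓝 0) := by
    have h := (hf.sub hg).isLittleO.comp_tendsto ht
    simp only [Function.comp_def, Pi.sub_apply, hf0, hg0, sub_self, sub_zero, smul_zero] at h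
    refine (h.norm_left.tendsto_div_nhds_zero).congr fun N => ?_
    rw [one_div, div_inv_eq_mul, mul_comm]
  rw [tendsto_zero_iff_norm_tendsto_zero]
  have hlim := hdiff.mul_const (Real.exp (C₁ + C₂))
  rw [zero_mul] at hlim
  refine squeeze_zero' (Eventually.of_forall fun _ => norm_nonneg _) ?_ hlim
  filter_upwards [h₁, h₂] with N hN₁ hN₂
  set t : ℝ := 1 / ((N : ℝ) + 1) with ht_def
  have ht0 : 0 ≤ t := by positivity
  -- This `M` dominates both norms since `1 + s ≤ exp s`; its `N`-th power stays below `exp (C₁ +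
  -- C₂)` because `t = 1 / (N + 1)`.
  refine (norm_pow_sub_pow_le (M := Real.exp ((C₁ + C₂) * t))
    (Real.one_le_exp (by positivity)) ?_ ?_ N).trans ?_
  · have := Real.add_one_le_exp ((C₁ + C₂) * t)
    nlinarith [mul_nonneg hC₂ ht0]
  · have := Real.add_one_le_exp ((C₁ + C₂) * t)
    nlinarith [mul_nonneg hC₁ ht0]
  · refine mul_le_mul_of_nonneg_left ?_ (mul_nonneg N.cast_add_one_pos.le (norm_nonneg _))
    rw [← Real.exp_nat_mul, Real.exp_le_exp, ht_def]
    have : (N : ℝ) / (N + 1) ≤ 1 := div_le_one_of_le₀ (by linarith) (by positivity)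
    calc (N : ℝ) * ((C₁ + C₂) * (1 / (N + 1))) = (C₁ + C₂) * (N / (N + 1)) := by ring
      _ ≤ C₁ + C₂ := mul_le_of_le_one_right (by positivity) this

/-- The **Lie product formula**. -/
theorem tendsto_exp_mul_exp_pow [CompleteSpace A] (a b : A) :
    Tendsto (fun N : ℕ => (exp ((1 / ((N : ℝ) + 1)) • a) * exp ((1 / ((N : ℝ) + 1)) • b)) ^ (N + 1))
      atTop (𝓝 (exp (a + b))) := by
  have hd : ∀ x : A, HasDerivAt (fun t : ℝ => exp (t • x)) x 0 := fun x => by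
    simpa using hasDerivAt_exp_smul_const (𝕂 := ℝ) x (0 : ℝ)
  have h := tendsto_pow_sub_pow_of_hasDerivAt (c := a + b)
    (f := fun t : ℝ => exp (t • a) * exp (t • b)) (g := fun t : ℝ => exp (t • (a + b)))
    (by simpa using! (hd a).mul (hd b)) (hd (a + b)) (by simp) (by simp)
  have hconst : ∀ N : ℕ, exp ((1 / ((N : ℝ) + 1)) • (a + b)) ^ (N + 1) = exp (a + b) := fun N => by
    let := NormedAlgebra.restrictScalars ℚ ℝ A
    rw [← NormedSpace.exp_nsmul, ← Nat.cast_smul_eq_nsmul ℝ, smul_smul]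
    congr 1
    rw [Nat.cast_add_one, mul_one_div_cancel (by positivity), one_smul]
  simp only [hconst] at h
  simpa using h.add_const (exp (a + b))

/-- The Lie product formula along powers of two. -/
theorem tendsto_exp_mul_exp_pow_two_pow [CompleteSpace A] (a b : A) :
    Tendsto (fun p : ℕ => (exp (((2 : ℝ) ^ p)⁻¹ • a) * exp (((2 : ℝ) ^ p)⁻¹ • b)) ^ 2 ^ p)
      atTop (𝓝 (exp (a + b))) := by
  have h2 : Tendsto (fun p : ℕ => 2 ^ p - 1) atTop atTop :=
    tendsto_atTop_mono (fun p => Nat.le_sub_one_of_lt Nat.lt_two_pow_self) tendsto_id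
  refine ((tendsto_exp_mul_exp_pow a b).comp h2).congr fun p => ?_
  have h1 : 1 ≤ 2 ^ p := Nat.one_le_two_pow
  simp only [Function.comp, Nat.cast_sub h1, Nat.sub_add_cancel h1]
  simp

end ProductFormula

/-! ### Norm inequalities in C⋆-algebras -/

section CStar

variable {A B : Type*} [CStarAlgebra A] [CStarAlgebra B]

theorem spectralRadius_mul_comm (a b : A) : spectralRadius ℂ (a * b) = spectralRadius ℂ (b * a) := by
  have key : ∀ x y : A, spectralRadius ℂ (x * y) ≤ spectralRadius ℂ (y * x) := fun x y => by
    refine iSup₂_le fun k hk => ?_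
    obtain rfl | hk0 := eq_or_ne k 0
    · simp
    · have : k ∈ spectrum ℂ (y * x) \ {0} := by
        rw [← spectrum.nonzero_mul_comm]; exact ⟨hk, hk0⟩
      exact le_iSup₂ (α := ENNReal)
        (f := fun k (_ : k ∈ spectrum ℂ (y * x)) => (‖k‖₊ : ENNReal)) k this.1
  exact le_antisymm (key a b) (key b a)

/-- The norm of a self-adjoint element is its spectral radius, which is unchanged by swapping
factors and never exceeds the norm. -/
theorem IsSelfAdjoint.norm_mul_le_norm_mul_swap {a b : A} (h : IsSelfAdjoint (a * b)) :
    ‖a * b‖ ≤ ‖b * a‖ := by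
  nontriviality A
  have := spectrum.spectralRadius_le_nnnorm (𝕜 := ℂ) (b * a)
  rw [← spectralRadius_mul_comm, h.spectralRadius_eq_nnnorm] at this
  exact_mod_cast this

theorem norm_mul_sq_le_norm_sq_mul_sq {a b : A} (ha : IsSelfAdjoint a) (hb : IsSelfAdjoint b) :
    ‖a * b‖ ^ 2 ≤ ‖a ^ 2 * b ^ 2‖ := by
  have h : star (a * b) * (a * b) = b * (a ^ 2 * b) := by
    rw [star_mul, ha.star_eq, hb.star_eq]; noncomm_ring
  have h' : a ^ 2 * b ^ 2 = (a ^ 2 * b) * b := by noncomm_ring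
  rw [sq ‖a * b‖, ← CStarRing.norm_star_mul_self, h, h']
  exact IsSelfAdjoint.norm_mul_le_norm_mul_swap (h ▸ IsSelfAdjoint.star_mul_self _)

theorem IsSelfAdjoint.exp_real_smul {a : A} (ha : IsSelfAdjoint a) (r : ℝ) :
    IsSelfAdjoint (NormedSpace.exp (r • a)) :=
  IsSelfAdjoint.exp (IsSelfAdjoint.smul (IsSelfAdjoint.all r) ha)

theorem exp_inv_two_pow_smul_pow (a : A) (p : ℕ) : exp (((2 : ℝ) ^ p)⁻¹ • a) ^ 2 ^ p = exp a := by
  let := NormedAlgebra.restrictScalars ℚ ℂ A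
  rw [← NormedSpace.exp_nsmul, ← Nat.cast_smul_eq_nsmul ℝ, smul_smul]
  simp

theorem exp_inv_two_pow_succ_smul_sq (a : A) (p : ℕ) :
    exp (((2 : ℝ) ^ (p + 1))⁻¹ • a) ^ 2 = exp (((2 : ℝ) ^ p)⁻¹ • a) := by
  let := NormedAlgebra.restrictScalars ℚ ℂ A
  rw [← NormedSpace.exp_nsmul, ← Nat.cast_smul_eq_nsmul ℝ, smul_smul]
  congr 2
  rw [pow_succ]; push_cast; field_simp

theorem exp_half_smul_sq (a : A) : exp ((1 / 2 : ℝ) • a) ^ 2 = exp a := by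
  simpa using exp_inv_two_pow_smul_pow a 1

theorem exp_I_smul_mem_unitary {a : A} (ha : IsSelfAdjoint a) :
    exp (Complex.I • a) ∈ unitary A := by
  let := NormedAlgebra.restrictScalars ℚ ℂ A
  refine exp_mem_unitary_of_mem_skewAdjoint ?_
  rw [skewAdjoint.mem_iff, star_smul, ha.star_eq]
  simp

variable (ρ : A →⋆* B)

/-- Cohen's inequality in operator norm. -/
theorem norm_map_exp_le (hρ : Continuous ρ) (a : A) : ‖ρ (exp a)‖ ≤ ‖ρ (exp (ℜ a : A))‖ := by
  -- The Lie formula needs `‖1‖ = 1`, which fails in the zero algebra.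
  cases subsingleton_or_nontrivial A
  · rw [Subsingleton.elim (exp a)]
  let := NormedAlgebra.restrictScalars ℝ ℂ A
  have hlim := (hρ.norm.tendsto _).comp
    (tendsto_exp_mul_exp_pow_two_pow (ℜ a : A) (Complex.I • (ℑ a : A)))
  rw [realPart_add_I_smul_imaginaryPart] at hlim
  refine le_of_tendsto' hlim fun p => ?_
  have hU : exp (((2 : ℝ) ^ p)⁻¹ • Complex.I • (ℑ a : A)) ∈ unitary A := by
    rw [smul_comm]
    exact exp_I_smul_mem_unitary (IsSelfAdjoint.smul (IsSelfAdjoint.all _) (ℑ a).2)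
  have hρU : ρ (exp (((2 : ℝ) ^ p)⁻¹ • Complex.I • (ℑ a : A))) ∈ unitary B := by
    rw [Unitary.mem_iff] at hU ⊢
    rw [← map_star, ← map_mul, ← map_mul, hU.1, hU.2, map_one]
    exact ⟨rfl, rfl⟩
  have hsa : IsSelfAdjoint (ρ (exp (((2 : ℝ) ^ p)⁻¹ • (ℜ a : A)))) :=
    (IsSelfAdjoint.exp_real_smul (ℜ a).2 _).map ρ
  calc ‖ρ ((exp (((2 : ℝ) ^ p)⁻¹ • (ℜ a : A)) *
        exp (((2 : ℝ) ^ p)⁻¹ • Complex.I • (ℑ a : A))) ^ 2 ^ p)‖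
      ≤ ‖ρ (exp (((2 : ℝ) ^ p)⁻¹ • (ℜ a : A))) *
          ρ (exp (((2 : ℝ) ^ p)⁻¹ • Complex.I • (ℑ a : A)))‖ ^ 2 ^ p := by
        rw [map_pow, map_mul]
        exact norm_pow_le' _ (by positivity)
    _ = ‖ρ (exp (ℜ a : A))‖ := by
        rw [CStarRing.norm_mul_mem_unitary _ hρU, ← hsa.norm_pow_two_pow, ← map_pow,
          exp_inv_two_pow_smul_pow]

/-- Squaring both factors undoes one halving of the exponents, so the left side decreases in `p`. -/
theorem norm_map_exp_mul_exp_pow_le {a b : A} (ha : IsSelfAdjoint a) (hb : IsSelfAdjoint b)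
    (p : ℕ) :
    ‖ρ (exp (((2 : ℝ) ^ p)⁻¹ • a) * exp (((2 : ℝ) ^ p)⁻¹ • b))‖ ^ 2 ^ p ≤ ‖ρ (exp a * exp b)‖ := by
  induction p with
  | zero => simp
  | succ p ih =>
    refine le_trans ?_ ih
    rw [pow_succ' (2 : ℕ) p, pow_mul, map_mul]
    refine pow_le_pow_left₀ (by positivity) ?_ _
    refine (norm_mul_sq_le_norm_sq_mul_sq ((ha.exp_real_smul _).map ρ)
      ((hb.exp_real_smul _).map ρ)).trans_eq ?_
    rw [← map_pow, ← map_pow, ← map_mul, exp_inv_two_pow_succ_smul_sq, exp_inv_two_pow_succ_smul_sq]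

theorem norm_map_exp_add_le (hρ : Continuous ρ) {a b : A} (ha : IsSelfAdjoint a)
    (hb : IsSelfAdjoint b) : ‖ρ (exp (a + b))‖ ≤ ‖ρ (exp a * exp b)‖ := by
  cases subsingleton_or_nontrivial A
  · rw [Subsingleton.elim (exp (a + b))]
  let := NormedAlgebra.restrictScalars ℝ ℂ A
  refine le_of_tendsto' ((hρ.norm.tendsto _).comp (tendsto_exp_mul_exp_pow_two_pow a b)) fun p => ?_
  refine le_trans ?_ (norm_map_exp_mul_exp_pow_le ρ ha hb p)
  simp only [Function.comp, map_pow]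
  exact norm_pow_le' _ (by positivity)

/-- Thompson's inequality in operator norm. -/
theorem norm_map_exp_add_le_norm_map_mul_mul (hρ : Continuous ρ) {a b : A} (ha : IsSelfAdjoint a)
    (hb : IsSelfAdjoint b) :
    ‖ρ (exp (a + b))‖ ≤ ‖ρ (exp ((1 / 2 : ℝ) • a) * exp b * exp ((1 / 2 : ℝ) • a))‖ := by
  have hab := (IsSelfAdjoint.exp_real_smul (ha.add hb) (1 / 2)).map ρ
  have h := norm_map_exp_add_le ρ hρ (IsSelfAdjoint.smul (IsSelfAdjoint.all (1 / 2 : ℝ)) ha)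
    (IsSelfAdjoint.smul (IsSelfAdjoint.all (1 / 2 : ℝ)) hb)
  rw [← smul_add] at h
  -- Square the bound for `a / 2`, `b / 2`: with `x = exp (a / 2) * exp (b / 2)`, the right side
  -- becomes the norm of `ρ (x * star x)`.
  have h1 := hab.norm_pow_two_pow 1
  rw [pow_one, ← map_pow, exp_half_smul_sq] at h1
  rw [h1]
  refine (pow_le_pow_left₀ (norm_nonneg _) h 2).trans_eq ?_
  rw [sq, ← CStarRing.norm_self_mul_star, ← map_star, ← map_mul, star_mul,
    (ha.exp_real_smul _).star_eq, (hb.exp_real_smul _).star_eq, ← exp_half_smul_sq b]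
  congr 2
  noncomm_ring

end CStar

/-! ### Compound matrices -/

section Compound

variable {I : Type*} [LinearOrder I] {R : Type*} [CommRing R]

namespace Matrix

/-- The `k`-th compound matrix: the matrix of `k × k` minors. -/
def compound (k : ℕ) (X : Matrix I I R) :
    Matrix (Set.powersetCard I k) (Set.powersetCard I k) R :=
  of fun s t => (X.submatrix (Set.powersetCard.ofFinEmbEquiv.symm s)
    (Set.powersetCard.ofFinEmbEquiv.symm t)).det

/-- Turns the Cauchy–Binet formula into functoriality of exterior powers. -/
theorem compound_eq_toMatrix [Fintype I] (k : ℕ) (X : Matrix I I R) :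
    compound k X = LinearMap.toMatrix ((Pi.basisFun R I).exteriorPower k)
      ((Pi.basisFun R I).exteriorPower k) (exteriorPower.map k (toLin' X)) := by
  ext s t
  rw [LinearMap.toMatrix_apply, exteriorPower.basis_repr_apply, exteriorPower.basis_apply,
    exteriorPower.map_apply_ιMulti_family, exteriorPower.ιMulti_family,
    exteriorPower.ιMultiDual_apply_ιMulti, compound, of_apply, ← det_transpose]
  congr 1
  ext i j
  simp

theorem compound_mul [Fintype I] (k : ℕ) (X Y : Matrix I I R) :
    compound k (X * Y) = compound k X * compound k Y := by
  simp only [compound_eq_toMatrix, toLin'_mul]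
  rw [exteriorPower.map_comp, LinearMap.toMatrix_comp _ ((Pi.basisFun R I).exteriorPower k)]

theorem compound_diagonal [Fintype I] (k : ℕ) (d : I → R) :
    compound k (diagonal d) = diagonal fun s : Set.powersetCard I k => ∏ i ∈ s.val, d i := by
  ext s t
  obtain rfl | hst := eq_or_ne s t
  · rw [compound, of_apply, submatrix_diagonal _ _ (RelEmbedding.injective _), det_diagonal,
      diagonal_apply_eq]
    conv_rhs => rw [← Finset.image_orderEmbOfFin_univ s.val s.2,
      Finset.prod_image fun _ _ _ _ h => (s.val.orderEmbOfFin s.2).injective h]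
    rfl
  · rw [diagonal_apply_ne _ hst, compound, of_apply]
    obtain ⟨i, his, hit⟩ := (Set.powersetCard.exists_mem_notMem_iff_ne s t).mp hst
    obtain ⟨j, rfl⟩ := (Set.powersetCard.mem_range_ofFinEmbEquiv_symm_iff_mem s i).mpr his
    refine det_eq_zero_of_row_eq_zero j fun l => ?_
    rw [submatrix_apply, diagonal_apply_ne]
    intro h
    exact hit (h ▸ (Set.powersetCard.mem_range_ofFinEmbEquiv_symm_iff_mem t _).mp ⟨l, rfl⟩)

theorem compound_one [Fintype I] (k : ℕ) : compound k (1 : Matrix I I R) = 1 := by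
  rw [← diagonal_one, compound_diagonal]
  simp

theorem compound_conjTranspose [StarRing R] (k : ℕ) (X : Matrix I I R) :
    compound k Xᴴ = (compound k X)ᴴ := by
  ext s t
  simp [compound, ← det_conjTranspose]

theorem continuous_compound [TopologicalSpace R] [IsTopologicalRing R] (k : ℕ) :
    Continuous (compound k : Matrix I I R → _) :=
  continuous_matrix fun _ _ => (continuous_id.matrix_submatrix _ _).matrix_det

/-- The compound matrix as a homomorphism of star monoids. -/
def compoundHom (I : Type*) [LinearOrder I] [Fintype I] (k : ℕ) :
    Matrix I I ℂ →⋆* Matrix (Set.powersetCard I k) (Set.powersetCard I k) ℂ where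
  toFun := compound k
  map_one' := compound_one k
  map_mul' := compound_mul k
  map_star' := compound_conjTranspose k

end Matrix

end Compound

/-! ### Products and sums of sorted sequences -/

section SortedProducts

variable {m : ℕ} {μ : Fin m → ℝ}

theorem Fin.prod_filter_val_lt {M : Type*} [CommMonoid M] (f : Fin m → M) {k : ℕ} (hk : k ≤ m) :
    ∏ j with j.val < k, f j = ∏ i : Fin k, f (Fin.castLE hk i) := by
  symm
  refine Finset.prod_bij (fun i _ => Fin.castLE hk i) ?_ ?_ ?_ ?_
  · simp
  · intro a _ b _ h
    simpa using h
  · intro b hb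
    exact ⟨⟨b, by simpa using hb⟩, by simp, rfl⟩
  · simp

theorem Fin.val_le_val_orderEmbedding {k : ℕ} (f : Fin k ↪o Fin m) (i : Fin k) :
    i.val ≤ (f i).val := by
  obtain ⟨i, hi⟩ := i
  induction i with
  | zero => exact Nat.zero_le _
  | succ i ih =>
    have h : f ⟨i, by omega⟩ < f ⟨i + 1, hi⟩ := f.strictMono (Nat.lt_succ_self i)
    have := ih (by omega)
    simp only [Fin.lt_def] at *
    omega

theorem prod_le_prod_filter_val_lt_of_antitone (hμ : Antitone μ) (h0 : ∀ i, 0 ≤ μ i)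
    (T : Finset (Fin m)) : ∏ j ∈ T, μ j ≤ ∏ j with j.val < T.card, μ j := by
  have hT : T.card ≤ m := by simpa using T.card_le_univ
  rw [Fin.prod_filter_val_lt _ hT]
  conv_lhs => rw [← T.image_orderEmbOfFin_univ rfl,
    Finset.prod_image fun _ _ _ _ h => (T.orderEmbOfFin rfl).injective h]
  exact Finset.prod_le_prod (fun _ _ => h0 _) fun i _ =>
    hμ (Fin.val_le_val_orderEmbedding (T.orderEmbOfFin rfl) i)

/-- Abel summation, run as an induction on partial sums. -/
theorem sum_mul_nonneg_of_antitone {x d : ℕ → ℝ} (hx : Antitone x) (h0 : ∀ j, 0 ≤ x j) {m : ℕ}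
    (hd : ∀ k ≤ m, 0 ≤ ∑ j ∈ Finset.range k, d j) : 0 ≤ ∑ j ∈ Finset.range m, x j * d j := by
  have key : ∀ k ≤ m, x k * ∑ j ∈ Finset.range k, d j ≤ ∑ j ∈ Finset.range k, x j * d j := by
    intro k
    induction k with
    | zero => simp
    | succ k ih =>
      intro hk
      have h1 := ih (by omega)
      have h2 := mul_le_mul_of_nonneg_right (hx k.le_succ) (hd (k + 1) hk)
      rw [Finset.sum_range_succ] at h2 ⊢
      rw [Finset.sum_range_succ]
      rw [mul_add (x k)] at h2
      linarith
  exact (mul_nonneg (h0 m) (hd m le_rfl)).trans (key m le_rfl)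

/-- Termwise `x * log (y / x) ≤ y - x`, and the left sides have nonnegative sum by Abel summation.
-/
theorem sum_le_sum_of_prod_filter_le {x y : Fin m → ℝ} (hx : Antitone x) (hx0 : ∀ i, 0 < x i)
    (hy0 : ∀ i, 0 < y i)
    (h : ∀ k ≤ m, ∏ j with j.val < k, x j ≤ ∏ j with j.val < k, y j) : ∑ i, x i ≤ ∑ i, y i := by
  let x' : ℕ → ℝ := fun j => if hj : j < m then x ⟨j, hj⟩ else 0
  let d : ℕ → ℝ := fun j => if hj : j < m then Real.log (y ⟨j, hj⟩) - Real.log (x ⟨j, hj⟩) else 0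
  have hx' : Antitone x' := by
    intro i j hij
    by_cases hj : j < m
    · simpa [x', hj, hij.trans_lt hj] using hx (show (⟨i, hij.trans_lt hj⟩ : Fin m) ≤ ⟨j, hj⟩ from hij)
    · by_cases hi : i < m
      · simpa [x', hj, hi] using (hx0 _).le
      · simp [x', hj, hi]
  have h0 : ∀ j, 0 ≤ x' j := fun j => by
    by_cases hj : j < m
    · simpa [x', hj] using (hx0 _).le
    · simp [x', hj]
  have hd : ∀ k ≤ m, 0 ≤ ∑ j ∈ Finset.range k, d j := fun k hk => by
    have h1 : ∑ j ∈ Finset.range k, d j =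
        ∑ i : Fin k, (Real.log (y (Fin.castLE hk i)) - Real.log (x (Fin.castLE hk i))) := by
      rw [← Fin.sum_univ_eq_sum_range]
      exact Finset.sum_congr rfl fun i _ => by simp [d, i.2.trans_le hk]; rfl
    have h2 := h k hk
    rw [Fin.prod_filter_val_lt _ hk, Fin.prod_filter_val_lt _ hk] at h2
    have h3 := Real.log_le_log (Finset.prod_pos fun i _ => hx0 _) h2
    rw [Real.log_prod fun i _ => (hx0 _).ne', Real.log_prod fun i _ => (hy0 _).ne'] at h3
    rw [h1, Finset.sum_sub_distrib]
    linarith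
  have key := sum_mul_nonneg_of_antitone hx' h0 hd
  rw [← Fin.sum_univ_eq_sum_range (fun j => x' j * d j)] at key
  rw [← sub_nonneg, ← Finset.sum_sub_distrib]
  refine key.trans (Finset.sum_le_sum fun i _ => ?_)
  simp only [x', d, i.2, dite_true, Fin.eta]
  have hlog := Real.log_le_sub_one_of_pos (div_pos (hy0 i) (hx0 i))
  rw [Real.log_div (hy0 i).ne' (hx0 i).ne'] at hlog
  have := mul_le_mul_of_nonneg_left hlog (hx0 i).le
  rwa [mul_sub (x i) (_ / _), mul_div_cancel₀ _ (hx0 i).ne', mul_one] at this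

end SortedProducts

/-! ### Log-majorization of matrix exponentials -/

section LogMajorization

open scoped Matrix.Norms.L2Operator

namespace Matrix

variable {n : ℕ}

theorem PosSemidef.eigenvalues₀_nonneg {X : Matrix (Fin n) (Fin n) ℂ} (hX : X.PosSemidef)
    (j : Fin (Fintype.card (Fin n))) : 0 ≤ hX.isHermitian.eigenvalues₀ j := by
  simpa [IsHermitian.eigenvalues] using
    hX.eigenvalues_nonneg (Fintype.equivOfCardEq (Fintype.card_fin _) j)

theorem PosDef.eigenvalues₀_pos {X : Matrix (Fin n) (Fin n) ℂ} (hX : X.PosDef)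
    (j : Fin (Fintype.card (Fin n))) : 0 < hX.isHermitian.eigenvalues₀ j := by
  simpa [IsHermitian.eigenvalues] using
    hX.eigenvalues_pos (Fintype.equivOfCardEq (Fintype.card_fin _) j)

/-- Unitary diagonalization leaves a diagonal compound whose entries are the `k`-fold eigenvalue
products; the largest takes the first `k`. -/
theorem PosSemidef.norm_compound {X : Matrix (Fin n) (Fin n) ℂ} (hX : X.PosSemidef) {k : ℕ}
    (hk : k ≤ n) :
    ‖compound k X‖ = ∏ j with j.val < k, hX.isHermitian.eigenvalues₀ j := by
  set μ := hX.isHermitian.eigenvalues₀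
  have hμ0 : ∀ j, 0 ≤ μ j := hX.eigenvalues₀_nonneg
  let e : Fin (Fintype.card (Fin n)) ≃ Fin n := Fintype.equivOfCardEq (Fintype.card_fin _)
  let U := hX.isHermitian.eigenvectorUnitary
  have hU : compound k (U : Matrix (Fin n) (Fin n) ℂ) ∈
      unitary (Matrix (Set.powersetCard (Fin n) k) (Set.powersetCard (Fin n) k) ℂ) := by
    have := U.2
    rw [Unitary.mem_iff] at this ⊢
    simp only [star_eq_conjTranspose] at this ⊢
    rw [← compound_conjTranspose, ← compound_mul, ← compound_mul, this.1, this.2, compound_one]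
    exact ⟨rfl, rfl⟩
  have hnorm : ‖compound k X‖ =
      ‖fun s : Set.powersetCard (Fin n) k => ∏ i ∈ s.val, (μ (e.symm i) : ℂ)‖ := by
    conv_lhs => rw [hX.isHermitian.spectral_theorem, Unitary.conjStarAlgAut_apply]
    rw [compound_mul, compound_mul, star_eq_conjTranspose, compound_conjTranspose, compound_diagonal,
      ← star_eq_conjTranspose, CStarRing.norm_mul_mem_unitary _ (Unitary.star_mem hU),
      CStarRing.norm_mem_unitary_mul _ hU, l2_opNorm_diagonal]
    rfl
  have hentry : ∀ s : Set.powersetCard (Fin n) k,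
      ‖∏ i ∈ s.val, (μ (e.symm i) : ℂ)‖ = ∏ j ∈ s.val.map e.symm.toEmbedding, μ j := fun s => by
    rw [norm_prod, Finset.prod_map]
    exact Finset.prod_congr rfl fun i _ => by simp [abs_of_nonneg (hμ0 _)]
  rw [hnorm]
  refine le_antisymm ?_ ?_
  · refine (pi_norm_le_iff_of_nonneg (Finset.prod_nonneg fun j _ => hμ0 j)).2 fun s => ?_
    rw [hentry]
    have := prod_le_prod_filter_val_lt_of_antitone hX.isHermitian.eigenvalues₀_antitone hμ0
      (s.val.map e.symm.toEmbedding)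
    rwa [Finset.card_map, s.2] at this
  · let T : Finset (Fin (Fintype.card (Fin n))) := Finset.univ.filter fun j => j.val < k
    have hT : (T.map e.toEmbedding).card = k := by
      rw [Finset.card_map, Fin.card_filter_val_lt, Fintype.card_fin, min_eq_right hk]
    have := norm_le_pi_norm (fun s : Set.powersetCard (Fin n) k =>
      ∏ i ∈ s.val, (μ (e.symm i) : ℂ)) ⟨T.map e.toEmbedding, hT⟩
    rw [hentry] at this
    simpa [T, Finset.map_map] using this

theorem PosSemidef.norm_det {X : Matrix (Fin n) (Fin n) ℂ} (hX : X.PosSemidef) :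
    ‖X.det‖ = ∏ j, hX.isHermitian.eigenvalues₀ j := by
  rw [hX.isHermitian.det_eq_prod_eigenvalues, norm_prod]
  refine Fintype.prod_equiv (Fintype.equivOfCardEq (Fintype.card_fin _)).symm _ _ fun i => ?_
  rw [RCLike.norm_ofReal, abs_of_nonneg (hX.eigenvalues_nonneg i)]
  rfl

theorem logMajorizedBy_of_norm_compound_le {X Y : Matrix (Fin n) (Fin n) ℂ} (hX : X.PosSemidef)
    (hY : Y.PosSemidef) (h : ∀ k, ‖compound k X‖ ≤ ‖compound k Y‖) (hdet : ‖X.det‖ = ‖Y.det‖) :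
    X ≺log Y := by
  refine ⟨hX, hY, fun k _ hk => ?_, ?_⟩
  · rw [← hX.norm_compound hk, ← hY.norm_compound hk]
    exact h k
  · rw [← hX.norm_det, ← hY.norm_det, hdet]

theorem LogMajorizedBy.trace_le {X Y : Matrix (Fin n) (Fin n) ℂ} (h : X ≺log Y) (hX : X.PosDef)
    (hY : Y.PosDef) : X.trace ≤ Y.trace := by
  obtain ⟨hX', hY', hle, -⟩ := h
  have hsum : ∀ {Z : Matrix (Fin n) (Fin n) ℂ} (hZ : Z.IsHermitian),
      Z.trace = ((∑ j, hZ.eigenvalues₀ j : ℝ) : ℂ) := fun hZ => by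
    rw [hZ.trace_eq_sum_eigenvalues, Complex.ofReal_sum]
    exact Fintype.sum_equiv (Fintype.equivOfCardEq (Fintype.card_fin _)).symm _ _ fun i => rfl
  rw [hsum hX'.isHermitian, hsum hY'.isHermitian, Complex.real_le_real]
  refine sum_le_sum_of_prod_filter_le hX'.isHermitian.eigenvalues₀_antitone hX.eigenvalues₀_pos
    hY.eigenvalues₀_pos fun k hk => ?_
  obtain rfl | hk0 := Nat.eq_zero_or_pos k
  · simp
  · exact hle k hk0 (by simpa using hk)

theorem posSemidef_abs (Z : Matrix (Fin n) (Fin n) ℂ) : (CFC.abs Z).PosSemidef :=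
  nonneg_iff_posSemidef.mp (CFC.abs_nonneg Z)

theorem abs_conjTranspose_mul_abs (Z : Matrix (Fin n) (Fin n) ℂ) :
    (CFC.abs Z)ᴴ * CFC.abs Z = Zᴴ * Z := by
  rw [(posSemidef_abs Z).isHermitian.eq, CFC.abs_mul_abs, star_eq_conjTranspose]

theorem norm_compound_abs (k : ℕ) (Z : Matrix (Fin n) (Fin n) ℂ) :
    ‖compound k (CFC.abs Z)‖ = ‖compound k Z‖ := by
  rw [← mul_self_inj (norm_nonneg _) (norm_nonneg _), ← l2_opNorm_conjTranspose_mul_self,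
    ← l2_opNorm_conjTranspose_mul_self, ← compound_conjTranspose, ← compound_mul,
    ← compound_conjTranspose, ← compound_mul, abs_conjTranspose_mul_abs]

theorem norm_det_abs (Z : Matrix (Fin n) (Fin n) ℂ) : ‖(CFC.abs Z).det‖ = ‖Z.det‖ := by
  have h := congrArg (fun M => ‖M.det‖) (abs_conjTranspose_mul_abs Z)
  simp only [det_mul, det_conjTranspose, norm_mul, norm_star] at h
  exact (mul_self_inj (norm_nonneg _) (norm_nonneg _)).mp h

/-- The determinant is constant along the Lie approximants. -/
theorem det_exp_add (A B : Matrix (Fin n) (Fin n) ℂ) :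
    (exp (A + B)).det = (exp A).det * (exp B).det := by
  cases isEmpty_or_nonempty (Fin n)
  · simp
  have hlim := ((continuous_id.matrix_det).tendsto (exp (A + B))).comp
    (tendsto_exp_mul_exp_pow_two_pow A B)
  refine tendsto_nhds_unique hlim (tendsto_const_nhds.congr fun p => ?_)
  simp only [Function.comp, id, det_pow, det_mul, mul_pow]
  rw [← det_pow, ← det_pow, exp_inv_two_pow_smul_pow, exp_inv_two_pow_smul_pow]

theorem norm_det_exp_realPart (Z : Matrix (Fin n) (Fin n) ℂ) :
    ‖(exp (ℜ Z : Matrix (Fin n) (Fin n) ℂ)).det‖ = ‖(exp Z).det‖ := by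
  have hU : exp (Complex.I • (ℑ Z : Matrix (Fin n) (Fin n) ℂ)) ∈
      unitary (Matrix (Fin n) (Fin n) ℂ) := exp_I_smul_mem_unitary (ℑ Z).2
  have h1 : ‖(exp (Complex.I • (ℑ Z : Matrix (Fin n) (Fin n) ℂ))).det‖ = 1 :=
    CStarRing.norm_of_mem_unitary (det_of_mem_unitary hU)
  conv_rhs => rw [← realPart_add_I_smul_imaginaryPart Z, det_exp_add, norm_mul, h1, mul_one]

theorem norm_det_exp_mul_exp_mul_exp (A B : Matrix (Fin n) (Fin n) ℂ) :
    ‖(exp ((1 / 2 : ℝ) • A) * exp B * exp ((1 / 2 : ℝ) • A)).det‖ = ‖(exp (A + B)).det‖ := by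
  rw [det_mul, det_mul, det_exp_add, ← exp_half_smul_sq A, det_pow]
  congr 1
  ring

theorem posDef_exp {S : Matrix (Fin n) (Fin n) ℂ} (hS : S.IsHermitian) :
    (exp S).PosDef := by
  have h : (exp S).PosSemidef := by
    have h2 := posSemidef_conjTranspose_mul_self (exp ((1 / 2 : ℝ) • S))
    rw [← star_eq_conjTranspose, IsSelfAdjoint.exp_real_smul hS (1 / 2)] at h2
    rwa [← exp_half_smul_sq S, sq]
  exact h.posDef_iff_isUnit.mpr (Matrix.isUnit_exp S)

theorem posDef_exp_mul_exp_mul_exp {S T : Matrix (Fin n) (Fin n) ℂ}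
    (hS : S.IsHermitian) (hT : T.IsHermitian) :
    (exp ((1 / 2 : ℝ) • S) * exp T * exp ((1 / 2 : ℝ) • S)).PosDef := by
  have h := (posDef_exp hT).conjTranspose_mul_mul_same (B := exp ((1 / 2 : ℝ) • S))
    (mulVec_injective_of_isUnit (Matrix.isUnit_exp _))
  rwa [← star_eq_conjTranspose, IsSelfAdjoint.exp_real_smul hS (1 / 2)] at h

theorem exp_add_logMajorizedBy {S T : Matrix (Fin n) (Fin n) ℂ} (hS : S.IsHermitian)
    (hT : T.IsHermitian) :
    exp (S + T) ≺log exp ((1 / 2 : ℝ) • S) * exp T * exp ((1 / 2 : ℝ) • S) :=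
  logMajorizedBy_of_norm_compound_le (posDef_exp (hS.add hT)).posSemidef
    (posDef_exp_mul_exp_mul_exp hS hT).posSemidef
    (fun k => norm_map_exp_add_le_norm_map_mul_mul (compoundHom (Fin n) k)
      (continuous_compound k) hS hT)
    (norm_det_exp_mul_exp_mul_exp S T).symm

theorem abs_exp_logMajorizedBy (Z : Matrix (Fin n) (Fin n) ℂ) :
    CFC.abs (exp Z) ≺log exp (ℜ Z : Matrix (Fin n) (Fin n) ℂ) := by
  refine logMajorizedBy_of_norm_compound_le (posSemidef_abs _)
    (posDef_exp (ℜ Z).2).posSemidef (fun k => ?_) ?_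
  · rw [norm_compound_abs]
    exact norm_map_exp_le (compoundHom (Fin n) k) (continuous_compound k) Z
  · rw [norm_det_abs, norm_det_exp_realPart]

theorem LogMajorizedBy.trans {X Y Z : Matrix (Fin n) (Fin n) ℂ} (h₁ : X ≺log Y) (h₂ : Y ≺log Z) :
    X ≺log Z := by
  obtain ⟨hX, hY, h, hn⟩ := h₁
  obtain ⟨_, hZ, h', hn'⟩ := h₂
  exact ⟨hX, hZ, fun k hk hkn => (h k hk hkn).trans (h' k hk hkn), hn.trans hn'⟩

end Matrix

end LogMajorization

theorem mainTheorem6 (n : ℕ) :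
    -- the log-majorization for arbitrary complex matrices
    (∀ A B : Matrix (Fin n) (Fin n) ℂ,
      CFC.abs (exp (A + B)) ≺log
        exp ((1 / 2 : ℝ) • (ℜ A : Matrix (Fin n) (Fin n) ℂ)) *
          exp (ℜ B : Matrix (Fin n) (Fin n) ℂ) *
          exp ((1 / 2 : ℝ) • (ℜ A : Matrix (Fin n) (Fin n) ℂ))) ∧
    -- Cohen
    (∀ Z : Matrix (Fin n) (Fin n) ℂ,
      CFC.abs (exp Z) ≺log exp (ℜ Z : Matrix (Fin n) (Fin n) ℂ)) ∧
    -- Thompson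
    (∀ S T : Matrix (Fin n) (Fin n) ℂ, S.IsHermitian → T.IsHermitian →
      exp (S + T) ≺log exp ((1 / 2 : ℝ) • S) * exp T * exp ((1 / 2 : ℝ) • S)) ∧
    -- Golden and Thompson (in the order on `ℂ`: the difference of the traces is real and nonnegative)
    (∀ S T : Matrix (Fin n) (Fin n) ℂ, S.IsHermitian → T.IsHermitian →
      (exp (S + T)).trace ≤
        (exp ((1 / 2 : ℝ) • S) * exp T * exp ((1 / 2 : ℝ) • S)).trace) := by
  refine ⟨fun A B => ?_, abs_exp_logMajorizedBy, fun S T => exp_add_logMajorizedBy,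
    fun S T hS hT => (exp_add_logMajorizedBy hS hT).trace_le (posDef_exp (hS.add hT))
      (posDef_exp_mul_exp_mul_exp hS hT)⟩
  have h := exp_add_logMajorizedBy (S := (ℜ A : Matrix (Fin n) (Fin n) ℂ))
    (T := (ℜ B : Matrix (Fin n) (Fin n) ℂ)) (ℜ A).2 (ℜ B).2
  refine LogMajorizedBy.trans ?_ h
  simpa using abs_exp_logMajorizedBy (A + B)
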